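/- Let $\mathrm{U}(1)=\{z\in\mathbb{C}:|z|=1\}$, and let $\rho:\mathrm{U}(1)\to\mathrm{GL}(V)$ and $\sigma:\mathrm{U}(1)\to\mathrm{GL}(W)$ be continuous, faithful representations of $\mathrm{U}(1)$ on finite-dimensional complex vector spaces $V$ and $W$, each of which is self-dual, that is, isomorphic to its dual representation. For $n\ge 0$ let $(V^{\otimes n})^{\mathrm{U}(1)}$ denote the space of vectors of $V^{\otimes n}$ that are fixed by the diagonal action $z\cdot(v_1\otimes\cdots\otimes v_n)=\rho(z)v_1\otimes\cdots\otimes\rho(z)v_n$, and define $(W^{\otimes n})^{\mathrm{U}(1)}$ likewise. If $$\dim (V^{\otimes n})^{\mathrm{U}(1)}=\dim (W^{\otimes n})^{\mathrm{U}(1)}\qquad\text{for every } n\ge 0,$$ then $\rho$ and $\sigma$ are isomorphic representations. In other words, a complex, finite-dimensional, self-dual, faithful continuous representation $\rho$ of $\mathrm{U}(1)$ is determined, up to isomorphism and among all such representations, by the function $n\mapsto\dim (V^{\otimes n})^{\mathrm{U}(1)}$. -/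

import Mathlib

open scoped TensorProduct

namespace U1Rep

/-- A finite-dimensional complex representation of a topological group `G` is continuous when all
its matrix coefficients `g ↦ φ (ρ g v)` are continuous functions on `G`. In finite dimension this
is the same as continuity of `G → GL(V)` for the canonical topology of `GL(V)`. -/
def IsContinuous {G V : Type*} [Group G] [TopologicalSpace G] [AddCommGroup V] [Module ℂ V]
    (ρ : Representation ℂ G V) : Prop :=
  ∀ (v : V) (φ : Module.Dual ℂ V), Continuous fun g : G => φ (ρ g v)

/-- A representation is self-dual when it is isomorphic to its dual (contragredient)
representation. -/
def IsSelfDual {G V : Type*} [Group G] [AddCommGroup V] [Module ℂ V]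
    (ρ : Representation ℂ G V) : Prop :=
  Nonempty (ρ.Equiv ρ.dual)

/-- A representation is faithful when only the identity of the group acts as the identity. -/
def IsFaithful {G V : Type*} [Group G] [AddCommGroup V] [Module ℂ V]
    (ρ : Representation ℂ G V) : Prop :=
  Function.Injective ρ

/-- The `n`-th tensor power `V^{⊗ n}` of a representation, with the diagonal action
`g (v₁ ⊗ ⋯ ⊗ vₙ) = g v₁ ⊗ ⋯ ⊗ g vₙ`. -/
noncomputable def tensorPower {G V : Type*} [Group G] [AddCommGroup V] [Module ℂ V]
    (ρ : Representation ℂ G V) (n : ℕ) : Representation ℂ G (⨂[ℂ]^n V) where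
  toFun g := PiTensorProduct.map fun _ : Fin n => ρ g
  map_one' := by simp
  map_mul' g h := by
    simp only [map_mul]
    exact PiTensorProduct.map_mul _ _

/-- The dimension of the space of `G`-invariants in `V^{⊗ n}`. -/
noncomputable def invariantDim {G V : Type*} [Group G] [AddCommGroup V] [Module ℂ V]
    (ρ : Representation ℂ G V) (n : ℕ) : ℕ :=
  Module.finrank ℂ (tensorPower ρ n).invariants

end U1Rep

namespace U1Rep

open MeasureTheory Set

/-! The multiset of weights determines a circle representation; self-duality makes its character a
sum of cosines in the angle. Expanding the `n`-th power of the character shows that the invariant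
dimension is its `n`-th moment for Haar measure (`invariantDim_eq_integral`), and moments fix the
law of a bounded function (`map_eq_map_of_integral_pow_eq`).

A law usually does not determine a function. Here faithfulness makes the maximum at angle `0`
unique, so superlevel sets just below it are intervals `(-t, t)`, and their measure `2t` recovers
the function near `0`; analyticity does the rest (`cosSum_eq_of_map_eq`). Fourier coefficients then
read off the weight multiplicities (`card_fiber_eq`). -/

/-- Bounded real random variables with the same moments have the same law. -/
theorem map_eq_map_of_integral_pow_eq {X : Type*} [MeasurableSpace X] (μ : Measure X)
    [IsFiniteMeasure μ] {f g : X → ℝ} (hf : Measurable f) (hg : Measurable g) {C : ℝ}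
    (hfC : ∀ x, |f x| ≤ C) (hgC : ∀ x, |g x| ≤ C)
    (h : ∀ n : ℕ, ∫ x, f x ^ n ∂μ = ∫ x, g x ^ n ∂μ) :
    μ.map f = μ.map g := by
  -- Boundedness lets the exponential series be integrated term by term, so the characteristic
  -- function is a power series in the moments.
  have key : ∀ u : X → ℝ, Measurable u → (∀ x, |u x| ≤ C) → ∀ t : ℝ,
      HasSum (fun n : ℕ => (t * Complex.I) ^ n / (n.factorial : ℂ) * ((∫ x, u x ^ n ∂μ : ℝ) : ℂ))
        (charFun (μ.map u) t) := by
    intro u hu huC t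
    rw [charFun_apply_real, integral_map hu.aemeasurable (by fun_prop)]
    have hterm : ∀ n : ℕ, (t * Complex.I) ^ n / (n.factorial : ℂ) * ((∫ x, u x ^ n ∂μ : ℝ) : ℂ) =
        ∫ x, (t * Complex.I * u x) ^ n / (n.factorial : ℂ) ∂μ := by
      intro n
      rw [← integral_complex_ofReal, ← integral_const_mul]
      refine integral_congr_ae (.of_forall fun x => ?_)
      push_cast
      ring
    simp_rw [hterm]
    refine hasSum_integral_of_dominated_convergence
      (fun n _ => (|t| * C) ^ n / (n.factorial : ℝ)) ?_ ?_ ?_ ?_ ?_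
    · intro n
      fun_prop
    · intro n
      refine .of_forall fun x => ?_
      simp only [norm_div, norm_pow, norm_mul, Complex.norm_real, Complex.norm_I, mul_one,
        Real.norm_eq_abs, Complex.norm_natCast]
      have := huC x
      gcongr
    · exact .of_forall fun _ => Real.summable_pow_div_factorial _
    · exact integrable_const _
    · refine .of_forall fun x => ?_
      have := NormedSpace.expSeries_div_hasSum_exp (t * Complex.I * u x)
      rw [← Complex.exp_eq_exp_ℂ] at this
      rwa [mul_right_comm (t : ℂ) (u x : ℂ)]
  refine Measure.ext_of_charFun (funext fun t => ?_)
  refine (key f hf hfC t).unique ?_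
  simp_rw [h]
  exact key g hg hgC t

/-! ### Sums of cosines and their superlevel sets -/

/-- The trigonometric polynomial `θ ↦ ∑ cos (kᵢ θ)`. -/
noncomputable def cosSum {ι : Type*} [Fintype ι] (k : ι → ℤ) (θ : ℝ) : ℝ :=
  ∑ i, Real.cos (k i * θ)

section cosSum

variable {ι κ : Type*} [Fintype ι] [Fintype κ]

theorem continuous_cosSum (k : ι → ℤ) : Continuous (cosSum k) := by
  unfold cosSum; fun_prop

theorem cosSum_neg (k : ι → ℤ) (θ : ℝ) : cosSum k (-θ) = cosSum k θ := by
  simp [cosSum]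

theorem cosSum_abs (k : ι → ℤ) (θ : ℝ) : cosSum k |θ| = cosSum k θ := by
  rcases abs_choice θ with h | h <;> rw [h]
  exact cosSum_neg k θ

theorem cosSum_le (k : ι → ℤ) (θ : ℝ) : cosSum k θ ≤ cosSum k 0 := by
  unfold cosSum
  gcongr
  simpa using Real.cos_le_one _

theorem abs_cosSum_le (k : ι → ℤ) (θ : ℝ) : |cosSum k θ| ≤ Fintype.card ι := by
  unfold cosSum
  refine (Finset.abs_sum_le_sum_abs _ _).trans ?_
  simpa using Finset.sum_le_sum fun i (_ : i ∈ Finset.univ) => Real.abs_cos_le_one (k i * θ)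

theorem analyticOnNhd_cosSum (k : ι → ℤ) : AnalyticOnNhd ℝ (cosSum k) univ := fun x _ => by
  unfold cosSum
  fun_prop

theorem superlevel_cosSum_eq_empty (k : ι → ℤ) : cosSum k ⁻¹' Ioi (cosSum k 0) = ∅ := by
  ext θ
  simp [cosSum_le k θ]

theorem volume_superlevel_cosSum_ne_zero (k : ι → ℤ) {c : ℝ} (hc : c < cosSum k 0) :
    volume (cosSum k ⁻¹' Ioi c ∩ Ioc (-Real.pi) Real.pi) ≠ 0 := by
  refine ne_of_gt (lt_of_lt_of_le ?_
    (measure_mono (inter_subset_inter_right _ Ioo_subset_Ioc_self)))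
  exact IsOpen.measure_pos _ ((isOpen_Ioi.preimage (continuous_cosSum k)).inter isOpen_Ioo)
    ⟨0, hc, by simp [Real.pi_pos]⟩

/-- Near `0` on the positive side a nonconstant sum of cosines is strictly decreasing. -/
theorem exists_strictAntiOn_cosSum (k : ι → ℤ) (hk : ∃ i, k i ≠ 0) :
    ∃ δ, 0 < δ ∧ δ < Real.pi ∧ StrictAntiOn (cosSum k) (Icc 0 δ) := by
  -- `K` dominates every frequency, so each argument stays in `[0, π]` on `[0, π / K]`; the `2`
  -- ensures `π / K < π`.
  set K : ℝ := 2 + ∑ i, |(k i : ℝ)| with hK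
  have hKi : ∀ i, |(k i : ℝ)| ≤ K := fun i => by
    have := Finset.single_le_sum (f := fun i => |(k i : ℝ)|) (fun j _ => abs_nonneg _)
      (Finset.mem_univ i)
    linarith
  have hK2 : 2 ≤ K := by
    have : 0 ≤ ∑ i, |(k i : ℝ)| := Finset.sum_nonneg fun j _ => abs_nonneg _
    linarith
  have hK0 : 0 < K := by linarith
  have hcos : ∀ i (θ : ℝ), Real.cos (k i * θ) = Real.cos (|(k i : ℝ)| * θ) := fun i θ => by
    rcases abs_choice (k i : ℝ) with h | h <;> rw [h]
    rw [neg_mul, Real.cos_neg]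
  have hle : ∀ i, ∀ y ∈ Icc 0 (Real.pi / K), |(k i : ℝ)| * y ≤ Real.pi := fun i y hy =>
    calc |(k i : ℝ)| * y ≤ K * (Real.pi / K) :=
          mul_le_mul (hKi i) hy.2 hy.1 hK0.le
      _ = Real.pi := by field_simp
  refine ⟨Real.pi / K, by positivity, ?_, ?_⟩
  · rw [div_lt_iff₀ hK0]
    nlinarith [Real.pi_pos]
  · intro x hx y hy hxy
    unfold cosSum
    simp_rw [hcos]
    obtain ⟨i, hi⟩ := hk
    refine Finset.sum_lt_sum (fun j _ => ?_) ⟨i, Finset.mem_univ i, ?_⟩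
    · exact Real.cos_le_cos_of_nonneg_of_le_pi (mul_nonneg (abs_nonneg _) hx.1) (hle j y hy)
        (mul_le_mul_of_nonneg_left hxy.le (abs_nonneg _))
    · have : 0 < |(k i : ℝ)| := abs_pos.2 (by exact_mod_cast hi)
      exact Real.cos_lt_cos_of_nonneg_of_le_pi (mul_nonneg this.le hx.1) (hle i y hy)
        (mul_lt_mul_of_pos_left hxy this)

/-- If the maximum at `0` is attained nowhere else on a period, then the superlevel sets close
to the maximum are symmetric intervals on which the sum of cosines is injective. -/
theorem exists_superlevel_cosSum_eq (k : ι → ℤ) (hk : ∃ i, k i ≠ 0)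
    (hmax : ∀ θ ∈ Ioc (-Real.pi) Real.pi, cosSum k θ = cosSum k 0 → θ = 0) :
    ∃ δ, 0 < δ ∧ δ < Real.pi ∧ StrictAntiOn (cosSum k) (Icc 0 δ) ∧
      ∀ t ∈ Ioo 0 δ, cosSum k ⁻¹' Ioi (cosSum k t) ∩ Ioc (-Real.pi) Real.pi = Ioo (-t) t := by
  obtain ⟨δ, hδ0, hδπ, hanti⟩ := exists_strictAntiOn_cosSum k hk
  obtain ⟨x, hx, hxmax⟩ := (isCompact_Icc (a := δ) (b := Real.pi)).exists_isMaxOn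
    ⟨δ, by simp [hδπ.le]⟩ (continuous_cosSum k).continuousOn
  have hx0 : 0 < x := hδ0.trans_le hx.1
  have hlt : cosSum k x < cosSum k 0 := by
    refine lt_of_le_of_ne (cosSum_le k x) fun h => hx0.ne' (hmax x ⟨?_, hx.2⟩ h)
    linarith
  -- Within `η` of `0` the values exceed the maximum over `[δ, π]`, so the superlevel sets avoid
  -- that range.
  obtain ⟨η, hη0, hη⟩ := Metric.eventually_nhds_iff.1
    ((continuous_cosSum k).continuousAt.eventually (lt_mem_nhds hlt))
  refine ⟨min δ η, lt_min hδ0 hη0, (min_le_left _ _).trans_lt hδπ,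
    hanti.mono (Icc_subset_Icc_right (min_le_left _ _)), fun t ht => ?_⟩
  have htδ : t < δ := ht.2.trans_le (min_le_left _ _)
  have htη : cosSum k x < cosSum k t := hη (by
    rw [Real.dist_eq, sub_zero, abs_of_pos ht.1]
    exact ht.2.trans_le (min_le_right _ _))
  ext θ
  simp only [mem_inter_iff, mem_preimage, mem_Ioi, mem_Ioc, mem_Ioo]
  rw [← abs_lt, ← cosSum_abs k θ]
  constructor
  · rintro ⟨h1, h2, h3⟩
    have hθδ : |θ| < δ := by
      by_contra! hcon
      have := hxmax (show |θ| ∈ Icc δ Real.pi from ⟨hcon, abs_le.2 ⟨h2.le, h3⟩⟩)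
      simp only [mem_ofPred_eq] at this
      linarith
    exact (hanti.lt_iff_gt ⟨ht.1.le, htδ.le⟩ ⟨abs_nonneg _, hθδ.le⟩).1 h1
  · intro h
    refine ⟨hanti ⟨abs_nonneg _, (h.trans htδ).le⟩ ⟨ht.1.le, htδ.le⟩ h, ?_, ?_⟩ <;>
    · have := abs_lt.1 h
      linarith

/-- A sum of cosines with unique maximum at `0` is determined by its law. -/
theorem cosSum_eq_of_map_eq (k : ι → ℤ) (l : κ → ℤ) (hk : ∃ i, k i ≠ 0) (hl : ∃ j, l j ≠ 0)
    (hkmax : ∀ θ ∈ Ioc (-Real.pi) Real.pi, cosSum k θ = cosSum k 0 → θ = 0)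
    (hlmax : ∀ θ ∈ Ioc (-Real.pi) Real.pi, cosSum l θ = cosSum l 0 → θ = 0)
    (h : (volume.restrict (Ioc (-Real.pi) Real.pi)).map (cosSum k) =
      (volume.restrict (Ioc (-Real.pi) Real.pi)).map (cosSum l)) :
    cosSum k = cosSum l := by
  have hvol : ∀ c, volume (cosSum k ⁻¹' Ioi c ∩ Ioc (-Real.pi) Real.pi) =
      volume (cosSum l ⁻¹' Ioi c ∩ Ioc (-Real.pi) Real.pi) := fun c => by
    have := congrArg (fun m => m (Ioi c)) h
    simpa only [Measure.map_apply (continuous_cosSum _).measurable measurableSet_Ioi,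
      Measure.restrict_apply ((continuous_cosSum _).measurable measurableSet_Ioi)] using this
  obtain ⟨δ, hδ0, hδπ, hka, hks⟩ := exists_superlevel_cosSum_eq k hk hkmax
  obtain ⟨ε, hε0, hεπ, hla, hls⟩ := exists_superlevel_cosSum_eq l hl hlmax
  have h0 : cosSum k 0 = cosSum l 0 := by
    rcases lt_trichotomy (cosSum k 0) (cosSum l 0) with hlt | heq | hlt
    · exact absurd ((hvol _).symm.trans (by
        rw [superlevel_cosSum_eq_empty, empty_inter, measure_empty]))
        (volume_superlevel_cosSum_ne_zero l hlt)
    · exact heq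
    · exact absurd ((hvol _).trans (by
        rw [superlevel_cosSum_eq_empty, empty_inter, measure_empty]))
        (volume_superlevel_cosSum_ne_zero k hlt)
  have hε2 : cosSum l (ε / 2) < cosSum k 0 := by
    rw [h0]
    exact hla ⟨le_rfl, hε0.le⟩ ⟨by linarith, by linarith⟩ (by linarith)
  obtain ⟨η, hη0, hη⟩ := Metric.eventually_nhds_iff.1
    ((continuous_cosSum k).continuousAt.eventually (lt_mem_nhds hε2))
  have hlocal : ∀ t ∈ Ioo 0 (min δ η), cosSum k t = cosSum l t := fun t ht => by
    have htδ : t < δ := ht.2.trans_le (min_le_left _ _)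
    have h1 : cosSum l (ε / 2) < cosSum k t := hη (by
      rw [Real.dist_eq, sub_zero, abs_of_pos ht.1]
      exact ht.2.trans_le (min_le_right _ _))
    have h2 : cosSum k t < cosSum l 0 := by
      rw [← h0]
      exact hka ⟨le_rfl, hδ0.le⟩ ⟨ht.1.le, htδ.le⟩ ht.1
    -- At this common level the superlevel sets are `(-t, t)` and `(-s, s)`; equal volumes force `t
    -- = s`.
    obtain ⟨s, hs, hst⟩ := intermediate_value_Ioo' (by linarith : (0 : ℝ) ≤ ε / 2)
      (continuous_cosSum l).continuousOn ⟨h1, h2⟩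
    have hv := hvol (cosSum k t)
    rw [hks t ⟨ht.1, htδ⟩, ← hst, hls s ⟨hs.1, by linarith [hs.2]⟩, Real.volume_Ioo,
      Real.volume_Ioo, ENNReal.ofReal_eq_ofReal_iff (by linarith [ht.1]) (by linarith [hs.1])] at hv
    have : t = s := by linarith
    rw [← hst, this]
  have hm : 0 < min δ η := lt_min hδ0 hη0
  -- Agreement was shown only for `t > 0`, so the identity theorem is applied at an interior point.
  refine (analyticOnNhd_cosSum k).eq_of_eventuallyEq (analyticOnNhd_cosSum l) (z₀ := min δ η / 2) ?_
  filter_upwards [Ioo_mem_nhds (half_pos hm) (half_lt_self hm)] with t ht using hlocal t ht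

end cosSum

/-! ### Fourier analysis on the circle -/

instance fact_zero_lt_two_pi : Fact (0 < 2 * Real.pi) := ⟨Real.two_pi_pos⟩

theorem fourier_eq_toCircle_zpow (k : ℤ) (x : AddCircle (2 * Real.pi)) :
    fourier k x = ((AddCircle.toCircle x ^ k : Circle) : ℂ) := by
  rw [fourier_apply, AddCircle.toCircle_zsmul]

theorem toCircle_surjective :
    Function.Surjective (AddCircle.toCircle : AddCircle (2 * Real.pi) → Circle) := fun z =>
  (AddCircle.homeomorphCircle Real.two_pi_pos.ne').surjective z |>.imp fun x hx => by
    rwa [AddCircle.homeomorphCircle_apply] at hx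

theorem toCircle_coe (θ : ℝ) :
    AddCircle.toCircle (θ : AddCircle (2 * Real.pi)) = Circle.exp θ := by
  rw [AddCircle.toCircle_apply_mk, div_self Real.two_pi_pos.ne', one_mul]

/-- A continuous function on the circle with vanishing Fourier coefficients vanishes. -/
theorem eq_zero_of_fourierCoeff_eq_zero (f : C(AddCircle (2 * Real.pi), ℂ))
    (h : ∀ k, fourierCoeff f k = 0) (x : AddCircle (2 * Real.pi)) : f x = 0 := by
  have hs : fourierCoeff f = 0 := funext h
  have := has_pointwise_sum_fourier_series_of_summable (f := f) (by rw [hs]; exact summable_zero) x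
  simp only [h, zero_smul] at this
  exact this.unique hasSum_zero

theorem coe_zpow_sum {ι : Type*} (z : Circle) (s : Finset ι) (k : ι → ℤ) :
    ((z ^ ∑ i ∈ s, k i : Circle) : ℂ) = ∏ i ∈ s, ((z ^ k i : Circle) : ℂ) := by
  classical
  induction s using Finset.induction_on with
  | empty => simp
  | insert a s ha ih =>
    rw [Finset.sum_insert ha, Finset.prod_insert ha, zpow_add, Circle.coe_mul, ih]

theorem fourierCoeff_sum_fourier {ι : Type*} [Fintype ι] (k : ι → ℤ) (m : ℤ) :
    fourierCoeff (fun x : AddCircle (2 * Real.pi) => ∑ i, (fourier (k i) x : ℂ)) m =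
      Fintype.card {i // k i = m} := by
  have : (fun x : AddCircle (2 * Real.pi) => ∑ i, (fourier (k i) x : ℂ)) =
      ∑ i, ⇑(fourier (k i) : C(AddCircle (2 * Real.pi), ℂ)) := by
    ext x
    rw [Finset.sum_apply]
  rw [this, fourierCoeff.sum, Finset.sum_apply]
  · simp [fourierCoeff_fourier, Pi.single_apply, Fintype.card_subtype, eq_comm]
  · intro p _
    exact Continuous.integrable_of_hasCompactSupport (map_continuous _)
      (HasCompactSupport.of_compactSpace _)

/-! ### Weights, characters and invariants -/

section weights

variable {V : Type*} [AddCommGroup V] [Module ℂ V]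

/-- `v` is a weight vector of weight `k`. -/
def IsWeightVector (ρ : Representation ℂ Circle V) (k : ℤ) (v : V) : Prop :=
  ∀ z : Circle, ρ z v = ((z ^ k : Circle) : ℂ) • v

/-- The Fourier coefficient `∫ z⁻ᵏ ρ(z) v dz`, characterised by its pairings with functionals. -/
theorem exists_fourierCoeff [FiniteDimensional ℂ V] {ρ : Representation ℂ Circle V}
    (hρ : IsContinuous ρ) (v : V) (k : ℤ) :
    ∃ u : V, ∀ φ : Module.Dual ℂ V,
      φ u = fourierCoeff (fun x : AddCircle (2 * Real.pi) => φ (ρ x.toCircle v)) k := by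
  let b := Module.finBasis ℂ V
  refine ⟨∑ i, fourierCoeff
    (fun x : AddCircle (2 * Real.pi) => b.coord i (ρ x.toCircle v)) k • b i, fun φ => ?_⟩
  have hexp : (fun x : AddCircle (2 * Real.pi) => φ (ρ x.toCircle v)) =
      ∑ i, φ (b i) • fun x : AddCircle (2 * Real.pi) => b.coord i (ρ x.toCircle v) := by
    ext x
    conv_lhs => rw [← b.sum_repr (ρ x.toCircle v), map_sum]
    simp only [map_smul, Finset.sum_apply, Pi.smul_apply, Module.Basis.coord_apply, smul_eq_mul,
      mul_comm]
  rw [hexp, fourierCoeff.sum, Finset.sum_apply, map_sum]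
  · refine Finset.sum_congr rfl fun i _ => ?_
    rw [fourierCoeff.const_smul, map_smul, smul_eq_mul, smul_eq_mul, mul_comm]
  · intro i _
    refine Integrable.smul _ (Continuous.integrable_of_hasCompactSupport ?_
      (HasCompactSupport.of_compactSpace _))
    exact (hρ v (b.coord i)).comp AddCircle.continuous_toCircle

/-- Translation invariance of Haar measure: shifting the variable by `y` pulls out the factor `y ^
k`. -/
theorem isWeightVector_of_fourierCoeff [FiniteDimensional ℂ V] {ρ : Representation ℂ Circle V}
    {v u : V} {k : ℤ}
    (hu : ∀ φ : Module.Dual ℂ V,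
      φ u = fourierCoeff (fun x : AddCircle (2 * Real.pi) => φ (ρ x.toCircle v)) k) :
    IsWeightVector ρ k u := by
  intro z
  obtain ⟨y, rfl⟩ := toCircle_surjective z
  rw [← sub_eq_zero, ← Module.forall_dual_apply_eq_zero_iff ℂ]
  intro φ
  rw [map_sub, sub_eq_zero, map_smul, hu φ]
  have := hu (φ ∘ₗ ρ y.toCircle)
  rw [LinearMap.comp_apply] at this
  rw [this, fourierCoeff, fourierCoeff, ← integral_smul,
    ← integral_add_left_eq_self (μ := AddCircle.haarAddCircle)
      (fun x => ((y.toCircle ^ k : Circle) : ℂ) • (fourier (-k) x : ℂ) • φ (ρ x.toCircle v)) y]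
  refine integral_congr_ae (.of_forall fun x => ?_)
  simp only [LinearMap.comp_apply, fourier_eq_toCircle_zpow, smul_eq_mul,
    AddCircle.toCircle_add, map_mul, Module.End.mul_apply, mul_zpow, Circle.coe_mul, zpow_neg,
    Circle.coe_inv]
  have hne := Circle.coe_ne_zero (y.toCircle ^ k)
  field_simp

/-- A continuous finite-dimensional representation of the circle has a basis of weight vectors. -/
theorem exists_weight_basis [FiniteDimensional ℂ V] {ρ : Representation ℂ Circle V}
    (hρ : IsContinuous ρ) :
    ∃ (d : ℕ) (b : Module.Basis (Fin d) ℂ V) (k : Fin d → ℤ), ∀ i, IsWeightVector ρ (k i) (b i) := by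
  -- A functional killing all weight vectors has matrix coefficients with zero Fourier coefficients;
  -- these vanish identically, so the functional is zero.
  have hspan : ⊤ ≤ Submodule.span ℂ {v : V | ∃ k, IsWeightVector ρ k v} := by
    by_contra hcon
    obtain ⟨φ, hφ, hle⟩ := Submodule.exists_le_ker_of_lt_top _ (lt_top_iff_ne_top.2
      fun h => hcon h.ge)
    refine hφ (LinearMap.ext fun v => ?_)
    have := eq_zero_of_fourierCoeff_eq_zero
      ⟨fun x => φ (ρ x.toCircle v), (hρ v φ).comp AddCircle.continuous_toCircle⟩ (fun k => ?_) 0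
    · simpa using this
    · obtain ⟨u, hu⟩ := exists_fourierCoeff hρ v k
      exact (hu φ).symm.trans
        (hle (Submodule.subset_span ⟨k, isWeightVector_of_fourierCoeff hu⟩))
  let b := Module.Basis.ofSpan hspan
  have : Finite ((linearIndepOn_empty ℂ (id : V → V)).extend
    (empty_subset {v : V | ∃ k, IsWeightVector ρ k v})) := Module.Finite.finite_basis b
  obtain ⟨d, ⟨e⟩⟩ := Finite.exists_equiv_fin ((linearIndepOn_empty ℂ (id : V → V)).extend
    (empty_subset {v : V | ∃ k, IsWeightVector ρ k v}))
  have hb : ∀ i, ∃ k, IsWeightVector ρ k (b.reindex e i) := fun i =>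
    Module.Basis.ofSpan_subset hspan (by simp [b])
  choose k hk using hb
  exact ⟨d, b.reindex e, k, hk⟩

theorem circle_exp_zpow (θ : ℝ) (n : ℤ) : Circle.exp θ ^ n = Circle.exp (n * θ) := by
  ext
  simp [Circle.coe_exp, ← Complex.exp_int_mul]

theorem exists_zpow_ne_one {n : ℤ} (hn : n ≠ 0) : ∃ z : Circle, z ^ n ≠ 1 := by
  refine ⟨Circle.exp (Real.pi / n), ?_⟩
  have : (n : ℝ) ≠ 0 := by exact_mod_cast hn
  rw [circle_exp_zpow, mul_div_cancel₀ _ this]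
  intro h
  have := congrArg (fun z : Circle => (z : ℂ).re) h
  norm_num [Circle.coe_exp, Complex.exp_pi_mul_I] at this

variable {ι : Type*} {ρ : Representation ℂ Circle V} {b : Module.Basis ι ℂ V} {k : ι → ℤ}

theorem eq_one_of_forall_zpow_eq_one (hb : ∀ i, IsWeightVector ρ (k i) (b i))
    (h : IsFaithful ρ) {z : Circle} (hz : ∀ i, z ^ k i = 1) : z = 1 := by
  refine h (b.ext fun i => ?_)
  rw [hb i z, hz, map_one]
  simp

theorem exists_weight_ne_zero (hb : ∀ i, IsWeightVector ρ (k i) (b i)) (h : IsFaithful ρ) :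
    ∃ i, k i ≠ 0 := by
  by_contra! hcon
  obtain ⟨z, hz⟩ := exists_zpow_ne_one one_ne_zero
  rw [zpow_one] at hz
  exact hz (eq_one_of_forall_zpow_eq_one hb h fun i => by rw [hcon i, zpow_zero])

theorem isWeightVector_piTensorProduct (hb : ∀ i, IsWeightVector ρ (k i) (b i)) (n : ℕ)
    (p : Fin n → ι) :
    IsWeightVector (tensorPower ρ n) (∑ j, k (p j))
      (Basis.piTensorProduct (fun _ : Fin n => b) p) := by
  intro z
  rw [Basis.piTensorProduct_apply]
  change PiTensorProduct.map (fun _ : Fin n => ρ z) _ = _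
  rw [PiTensorProduct.map_tprod]
  simp only [hb _ z]
  rw [MultilinearMap.map_smul_univ, coe_zpow_sum]

variable [Fintype ι]

theorem repr_apply_of_weight_basis (hb : ∀ i, IsWeightVector ρ (k i) (b i)) (z : Circle) (v : V)
    (i : ι) : b.repr (ρ z v) i = ((z ^ k i : Circle) : ℂ) * b.repr v i := by
  classical
  conv_lhs => rw [← b.sum_repr v, map_sum]
  simp only [map_smul, hb _ z, map_sum, Finsupp.coe_finsetSum, Finset.sum_apply,
    Module.Basis.repr_self, Finsupp.smul_apply, Finsupp.single_apply, smul_eq_mul]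
  simp [mul_comm]

/-- The dimension of the invariants is the multiplicity of the weight `0`. -/
theorem finrank_invariants_of_weight_basis (hb : ∀ i, IsWeightVector ρ (k i) (b i)) :
    Module.finrank ℂ ρ.invariants = Fintype.card {i // k i = 0} := by
  have hinv : ρ.invariants = Submodule.span ℂ (b '' {i | k i = 0}) := by
    ext v
    rw [Module.Basis.mem_span_image, Representation.mem_invariants]
    constructor
    · intro hv i hi
      by_contra hne
      obtain ⟨z, hz⟩ := exists_zpow_ne_one hne
      have h1 := repr_apply_of_weight_basis hb z v i
      rw [hv z] at h1
      refine hz (Circle.ext ?_)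
      rw [Circle.coe_one]
      exact (mul_eq_right₀ (Finsupp.mem_support_iff.1 hi)).1 h1.symm
    · intro hv z
      refine b.ext_elem fun i => ?_
      rw [repr_apply_of_weight_basis hb]
      by_cases hi : b.repr v i = 0
      · simp [hi]
      · have : k i = 0 := hv (Finsupp.mem_support_iff.2 hi)
        simp [this]
  rw [hinv, image_eq_range]
  exact finrank_span_eq_card (b.linearIndependent.comp _ Subtype.val_injective)

/-- The character of a representation with given weights. -/
theorem trace_of_weight_basis (hb : ∀ i, IsWeightVector ρ (k i) (b i)) (z : Circle) :
    LinearMap.trace ℂ V (ρ z) = ∑ i, ((z ^ k i : Circle) : ℂ) := by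
  classical
  rw [LinearMap.trace_eq_matrix_trace ℂ b, Matrix.trace]
  refine Finset.sum_congr rfl fun i _ => ?_
  rw [Matrix.diag_apply, LinearMap.toMatrix_apply, repr_apply_of_weight_basis hb]
  simp

theorem trace_inv_of_isSelfDual [FiniteDimensional ℂ V] (h : IsSelfDual ρ) (z : Circle) :
    LinearMap.trace ℂ V (ρ z⁻¹) = LinearMap.trace ℂ V (ρ z) := by
  obtain ⟨e⟩ := h
  rw [← LinearMap.trace_conj' (ρ z) e.toLinearEquiv, Representation.Equiv.conj_apply_self]
  exact (LinearMap.trace_transpose' (ρ z⁻¹)).symm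

/-- The character of a self-dual representation is a sum of cosines. -/
theorem sum_zpow_eq_cosSum [FiniteDimensional ℂ V] (hb : ∀ i, IsWeightVector ρ (k i) (b i))
    (h : IsSelfDual ρ) (θ : ℝ) :
    ∑ i, ((Circle.exp θ ^ k i : Circle) : ℂ) = (cosSum k θ : ℂ) := by
  have h1 := trace_inv_of_isSelfDual h (Circle.exp θ)
  rw [trace_of_weight_basis hb, trace_of_weight_basis hb, ← Circle.exp_neg] at h1
  have h2 : ∑ i, ((Circle.exp θ ^ k i : Circle) : ℂ) + ∑ i, ((Circle.exp (-θ) ^ k i : Circle) : ℂ)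
      = 2 * (cosSum k θ : ℂ) := by
    rw [← Finset.sum_add_distrib, cosSum, Complex.ofReal_sum, Finset.mul_sum]
    refine Finset.sum_congr rfl fun i _ => ?_
    rw [circle_exp_zpow, circle_exp_zpow, Circle.coe_exp, Circle.coe_exp, Complex.ofReal_cos,
      Complex.two_cos]
    simp
  rw [h1] at h2
  linear_combination h2 / 2

/-- The dimension of the invariants of a tensor power is a moment of the character. -/
theorem invariantDim_eq_integral [FiniteDimensional ℂ V]
    (hb : ∀ i, IsWeightVector ρ (k i) (b i)) (h : IsSelfDual ρ) (n : ℕ) :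
    (invariantDim ρ n : ℝ) =
      (1 / (2 * Real.pi)) * ∫ θ in Ioc (-Real.pi) Real.pi, cosSum k θ ^ n := by
  rw [invariantDim, finrank_invariants_of_weight_basis (isWeightVector_piTensorProduct hb n)]
  let χ : AddCircle (2 * Real.pi) → ℂ := fun x => (∑ i, (fourier (k i) x : ℂ)) ^ n
  have hχ : χ = fun x => ∑ p : Fin n → ι, (fourier (∑ j, k (p j)) x : ℂ) := by
    ext x
    simp only [χ, fourier_eq_toCircle_zpow, coe_zpow_sum]
    exact Fintype.sum_pow _ _
  have h1 := fourierCoeff_sum_fourier (fun p : Fin n → ι => ∑ j, k (p j)) 0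
  rw [← hχ] at h1
  have h2 := fourierCoeff_eq_intervalIntegral χ 0 (-Real.pi)
  have h3 : ∀ θ : ℝ, χ θ = ((cosSum k θ ^ n : ℝ) : ℂ) := fun θ => by
    simp only [χ, fourier_eq_toCircle_zpow, toCircle_coe]
    rw [sum_zpow_eq_cosSum hb h]
    push_cast
    rfl
  rw [h1] at h2
  simp only [h3, neg_zero, fourier_zero, one_smul] at h2
  rw [intervalIntegral.integral_ofReal, intervalIntegral.integral_of_le
    (by linarith [Real.pi_pos]), show -Real.pi + 2 * Real.pi = Real.pi by ring] at h2
  rw [Complex.real_smul] at h2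
  exact_mod_cast h2

/-- Equality forces every cosine to be `1`, so `Circle.exp θ` acts trivially and faithfulness
applies. -/
theorem eq_zero_of_cosSum_eq (hb : ∀ i, IsWeightVector ρ (k i) (b i)) (h : IsFaithful ρ) {θ : ℝ}
    (hθ : θ ∈ Ioc (-Real.pi) Real.pi) (heq : cosSum k θ = cosSum k 0) : θ = 0 := by
  have hcos : ∀ i, Real.cos (k i * θ) = 1 := fun i => by
    have := (Finset.sum_eq_sum_iff_of_le (s := Finset.univ)
      (fun i _ => Real.cos_le_one (k i * θ))).1 (by simpa [cosSum] using heq)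
    exact this i (Finset.mem_univ i)
  have : Circle.exp θ = 1 := eq_one_of_forall_zpow_eq_one hb h fun i => by
    rw [circle_exp_zpow]
    obtain ⟨n, hn⟩ := (Real.cos_eq_one_iff _).1 (hcos i)
    rw [← hn, Circle.exp_eq_one]
    exact ⟨n, rfl⟩
  obtain ⟨n, hn⟩ := Circle.exp_eq_one.1 this
  have h1 : (-1 : ℝ) < n := by nlinarith [Real.pi_pos, hθ.1]
  have h2 : (n : ℝ) < 1 := by nlinarith [Real.pi_pos, hθ.2]
  have h3 : n = 0 := by
    have h1' : (-1 : ℤ) < n := by exact_mod_cast h1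
    have h2' : n < 1 := by exact_mod_cast h2
    omega
  simp [hn, h3]

end weights

/-! ### From characters back to representations -/

/-- The exponential sum determines the multiplicities of the weights. -/
theorem card_fiber_eq {ι κ : Type*} [Fintype ι] [Fintype κ] (k : ι → ℤ) (l : κ → ℤ)
    (h : ∀ θ : ℝ, ∑ i, ((Circle.exp θ ^ k i : Circle) : ℂ) =
      ∑ j, ((Circle.exp θ ^ l j : Circle) : ℂ)) (m : ℤ) :
    Fintype.card {i // k i = m} = Fintype.card {j // l j = m} := by
  have := fourierCoeff_sum_fourier k m
  have hkl : (fun x : AddCircle (2 * Real.pi) => ∑ i, (fourier (k i) x : ℂ)) =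
      fun x => ∑ j, (fourier (l j) x : ℂ) := by
    ext x
    induction x using QuotientAddGroup.induction_on with
    | H θ => simpa only [fourier_eq_toCircle_zpow, ← toCircle_coe] using h θ
  rw [hkl, fourierCoeff_sum_fourier] at this
  exact_mod_cast this.symm

/-- Representations with weight bases of equal multiplicities are isomorphic. -/
theorem nonempty_equiv_of_card_fiber_eq {V W : Type*} [AddCommGroup V] [Module ℂ V]
    [AddCommGroup W] [Module ℂ W] {ρ : Representation ℂ Circle V} {σ : Representation ℂ Circle W}
    {ι κ : Type*} [Fintype ι] [Fintype κ] {b : Module.Basis ι ℂ V} {c : Module.Basis κ ℂ W}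
    {k : ι → ℤ} {l : κ → ℤ} (hb : ∀ i, IsWeightVector ρ (k i) (b i))
    (hc : ∀ j, IsWeightVector σ (l j) (c j))
    (h : ∀ m, Fintype.card {i // k i = m} = Fintype.card {j // l j = m}) :
    Nonempty (ρ.Equiv σ) := by
  let e : ι ≃ κ := (Equiv.sigmaFiberEquiv k).symm.trans
    ((Equiv.sigmaCongrRight fun m => Fintype.equivOfCardEq (h m)).trans (Equiv.sigmaFiberEquiv l))
  have he : ∀ i, l (e i) = k i := fun i => (Fintype.equivOfCardEq (h (k i)) ⟨i, rfl⟩).2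
  refine ⟨.mk (b.equiv c e) fun z => b.ext fun i => ?_⟩
  simp [hb i z, hc (e i) z, he i]

end U1Rep

theorem corollary2 {V W : Type*}
    [AddCommGroup V] [Module ℂ V] [FiniteDimensional ℂ V]
    [AddCommGroup W] [Module ℂ W] [FiniteDimensional ℂ W]
    (ρ : Representation ℂ Circle V) (σ : Representation ℂ Circle W)
    (hρ_cont : U1Rep.IsContinuous ρ) (hσ_cont : U1Rep.IsContinuous σ)
    (hρ_dual : U1Rep.IsSelfDual ρ) (hσ_dual : U1Rep.IsSelfDual σ)
    (hρ_faithful : U1Rep.IsFaithful ρ) (hσ_faithful : U1Rep.IsFaithful σ)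
    (h : ∀ n : ℕ, U1Rep.invariantDim ρ n = U1Rep.invariantDim σ n) :
    Nonempty (ρ.Equiv σ) := by
  obtain ⟨d, b, k, hb⟩ := U1Rep.exists_weight_basis hρ_cont
  obtain ⟨e, c, l, hc⟩ := U1Rep.exists_weight_basis hσ_cont
  refine U1Rep.nonempty_equiv_of_card_fiber_eq hb hc (U1Rep.card_fiber_eq k l fun θ => ?_)
  rw [U1Rep.sum_zpow_eq_cosSum hb hρ_dual, U1Rep.sum_zpow_eq_cosSum hc hσ_dual]
  have hlaw := U1Rep.map_eq_map_of_integral_pow_eq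
    (MeasureTheory.volume.restrict (Set.Ioc (-Real.pi) Real.pi))
    (U1Rep.continuous_cosSum k).measurable (U1Rep.continuous_cosSum l).measurable
    (fun θ => (U1Rep.abs_cosSum_le k θ).trans (le_max_left _ _))
    (fun θ => (U1Rep.abs_cosSum_le l θ).trans (le_max_right _ _)) fun n => by
      have hn := congrArg (Nat.cast : ℕ → ℝ) (h n)
      rw [U1Rep.invariantDim_eq_integral hb hρ_dual, U1Rep.invariantDim_eq_integral
        hc hσ_dual] at hn
      exact mul_left_cancel₀ (by positivity) hn
  rw [U1Rep.cosSum_eq_of_map_eq k l (U1Rep.exists_weight_ne_zero hb hρ_faithful)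
    (U1Rep.exists_weight_ne_zero hc hσ_faithful)
    (fun _ => U1Rep.eq_zero_of_cosSum_eq hb hρ_faithful)
    (fun _ => U1Rep.eq_zero_of_cosSum_eq hc hσ_faithful) hlaw]
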